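/- Let $X$ be a Tychonoff space. Suppose that $X$ is airy, i.e. there is a countable family $\mathcal P$ of infinite subsets of $X$ such that $G_1\cap G_2\neq\emptyset$ for any two $G_\delta$-sets $G_1,G_2\subseteq X$ that are $\mathcal P$-dense, where $G\subseteq X$ is called $\mathcal P$-dense if $G\cap P\neq\emptyset$ for every $P\in\mathcal P$. Let $C_p(X)$ be the set of all continuous functions $X\to\mathbb R$ with the topology of pointwise convergence. Then $C_p(X)$ has the Banakh property: there is a sequence $(A_n)_{n\in\mathbb N}$ of closed nowhere dense subsets of $C_p(X)$ such that every compact subset of $C_p(X)$ is contained in $A_n$ for some $n\in\mathbb N$. -/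

import Mathlib

/-- A subset `G` of `X` is dense with respect to a family `P` of subsets of `X` if it meets every
member of `P`. -/
def FamilyDense {X : Type*} (P : Set (Set X)) (G : Set X) : Prop :=
  ∀ S ∈ P, (G ∩ S).Nonempty

/-- A topological space `X` is airy if it admits a countable family `P` of infinite subsets such
that any two `P`-dense `Gδ`-sets have nonempty intersection. -/
def IsAiry (X : Type*) [TopologicalSpace X] : Prop :=
  ∃ P : Set (Set X), P.Countable ∧ (∀ S ∈ P, S.Infinite) ∧
    ∀ G₁ G₂ : Set X, IsGδ G₁ → IsGδ G₂ → FamilyDense P G₁ → FamilyDense P G₂ →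
      (G₁ ∩ G₂).Nonempty

/-- The Banakh property: there is a countable family of closed nowhere dense sets such that every
compact set is contained in a member of the family. -/
def BanakhProperty (Y : Type*) [TopologicalSpace Y] : Prop :=
  ∃ A : ℕ → Set Y, (∀ n, IsClosed (A n) ∧ IsNowhereDense (A n)) ∧
    ∀ K : Set Y, IsCompact K → ∃ n, K ⊆ A n

/-- The space `C_p(X)` of continuous real-valued functions on `X`. Its topology is the subspace
topology inherited from the product space `X → ℝ`, that is, the topology of pointwise
convergence. -/
abbrev Cp (X : Type*) [TopologicalSpace X] : Type _ :=
  {f : X → ℝ // Continuous f}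

open Bornology Function Set Topology

/-!
The sets `A n` consist of the functions bounded by a given natural number on a given member of the
airiness family `P`. They are nowhere dense because the members of `P` are infinite, while a basic
open set of `Cp X` restricts the values at finitely many points only. Suppose that no `A n` contains
the pointwise bounded set `K`. For `S ∈ P` and `n : ℕ`, the points of `S` at which some `f ∈ K` has
`n < |f|` then form an infinite set. Hence two such points can be chosen for every `S ∈ P`, all of
them distinct, with `n` growing to infinity along the choice. The open sets `{n < |f|}` around the
chosen points form a point-finite family, since `K` is bounded at each point. In a Hausdorff space,
two disjoint countable sets whose points have point-finite families of open neighborhoods are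
separated by disjoint `Gδ`-sets; here these are `P`-dense, contradicting airiness.
-/

theorem exists_injective_forall_mem_of_infinite {ι α : Type*} [Countable ι] {B : ι → Set α}
    (hB : ∀ i, (B i).Infinite) : ∃ z : ι → α, Injective z ∧ ∀ i, z i ∈ B i := by
  classical
  obtain ⟨e, he⟩ := exists_injective_nat ι
  choose t htB htcard using fun i => (hB i).exists_subset_card_eq (e i + 1)
  have hall : ∀ s : Finset ι, s.card ≤ (s.biUnion t).card := by
    intro s
    obtain rfl | hs := s.eq_empty_or_nonempty
    · simp
    obtain ⟨m, hms, hm⟩ := s.exists_max_image e hs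
    calc s.card ≤ (Finset.range (e m + 1)).card :=
          Finset.card_le_card_of_injOn e
            (fun i hi => Finset.mem_coe.2 (Finset.mem_range_succ_iff.2 (hm i hi))) he.injOn
      _ = (t m).card := by rw [Finset.card_range, htcard]
      _ ≤ (s.biUnion t).card := Finset.card_le_card (Finset.subset_biUnion_of_mem t hms)
  obtain ⟨z, hz, hzt⟩ := (Finset.all_card_le_biUnion_card_iff_exists_injective t).1 hall
  exact ⟨z, hz, fun i => htB i (hzt i)⟩

theorem iUnion_iInter_eq_of_pointFinite {ι α : Type*} {W : ι → ℕ → Set α}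
    (hfin : ∀ x, {i | x ∈ W i 0}.Finite) (hanti : ∀ i, Antitone (W i)) :
    ⋃ i, ⋂ n, W i n = ⋂ n, ⋃ i, W i n := by
  refine iUnion_iInter_subset.antisymm fun x hx => ?_
  by_contra hnot
  simp only [mem_iUnion, mem_iInter, not_exists, not_forall] at hx hnot
  choose n hn using hnot
  obtain ⟨N, hN⟩ := ((hfin x).image n).bddAbove
  obtain ⟨i, hi⟩ := hx N
  have hniN : n i ≤ N := hN (mem_image_of_mem n (hanti i N.zero_le hi))
  exact hn i (hanti i hniN hi)

section GDelta

variable {X ι : Type*} [TopologicalSpace X]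

theorem isGδ_iUnion_of_pointFinite {G V : ι → Set X} (hG : ∀ i, IsGδ (G i))
    (hV : ∀ i, IsOpen (V i)) (hfin : ∀ x, {i | x ∈ V i}.Finite) (hGV : ∀ i, G i ⊆ V i) :
    IsGδ (⋃ i, G i) := by
  choose U hU hGU using fun i => (hG i).eq_iInter_nat
  let W : ι → ℕ → Set X := fun i n => V i ∩ dissipate (U i) n
  have hWopen : ∀ i n, IsOpen (W i n) := fun i n =>
    (hV i).inter ((finite_Iic n).isOpen_biInter fun k _ => hU i k)
  have hGW : ∀ i, G i = ⋂ n, W i n := fun i => by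
    rw [← inter_iInter, iInter_dissipate, ← hGU, inter_eq_right.2 (hGV i)]
  have hWfin : ∀ x, {i | x ∈ W i 0}.Finite := fun x => (hfin x).subset fun i hi => hi.1
  have hWanti : ∀ i, Antitone (W i) := fun i _ _ hmn =>
    inter_subset_inter_right _ (antitone_dissipate hmn)
  rw [iUnion_congr hGW, iUnion_iInter_eq_of_pointFinite hWfin hWanti]
  exact .iInter_of_isOpen fun n => isOpen_iUnion fun i => hWopen i n

theorem exists_pairwise_disjoint_isGδ_of_injective [T2Space X] [Countable ι] {z : ι → X}
    (hz : Injective z) :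
    ∃ G : ι → Set X, (∀ i, IsGδ (G i)) ∧ (∀ i, z i ∈ G i) ∧ Pairwise (Disjoint on G) := by
  choose U V hU hV hzU hzV hdisj using
    fun (i j : ι) (hij : i ≠ j) => t2_separation (hz.ne hij)
  refine ⟨fun i => ⋂ (j) (hij : i ≠ j), U i j hij ∩ V j i hij.symm, fun i => ?_, fun i => ?_,
    fun i j hij => ?_⟩
  · exact .iInter fun j => .iInter_of_isOpen fun hij => (hU i j hij).inter (hV j i hij.symm)
  · exact mem_iInter₂.2 fun j hij => ⟨hzU i j hij, hzV j i hij.symm⟩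
  · exact (hdisj i j hij).mono ((iInter₂_subset j hij).trans inter_subset_left)
      ((iInter₂_subset i hij.symm).trans inter_subset_right)

end GDelta

theorem exists_continuous_eqOn_zero_eq_one {X : Type*} [TopologicalSpace X]
    (hsep : SeparatesPoints {f : X → ℝ | Continuous f}) {F : Finset X} {x : X} (hx : x ∉ F) :
    ∃ φ : X → ℝ, Continuous φ ∧ EqOn φ 0 F ∧ φ x = 1 := by
  have hxF : ∀ a ∈ F, x ≠ a := fun a ha hxa => hx (hxa ▸ ha)
  choose! g hg hgne using fun a ha => hsep (hxF a ha)
  refine ⟨fun y => ∏ a ∈ F, (g a y - g a a) / (g a x - g a a), ?_, fun a ha => ?_, ?_⟩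
  · exact continuous_finsetProd F fun a ha =>
      ((hg a ha).sub continuous_const).div_const _
  · exact Finset.prod_eq_zero ha (by rw [sub_self, zero_div])
  · exact Finset.prod_eq_one fun a ha => div_self (sub_ne_zero.2 (hgne a ha))

namespace Cp

variable {X : Type*} [TopologicalSpace X]

/-- The set of continuous functions bounded by `r` in absolute value on `S`. -/
def boundedOn (S : Set X) (r : ℝ) : Set (Cp X) :=
  {f | ∀ x ∈ S, |f.1 x| ≤ r}

/-- A set of continuous functions is pointwise bounded if its values at each point form a bounded
set. Compactness in `Cp X` enters the argument through this property. -/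
def IsPointwiseBounded (K : Set (Cp X)) : Prop :=
  ∀ x, IsBounded ((fun f : Cp X => f.1 x) '' K)

theorem continuous_eval (x : X) : Continuous fun f : Cp X => f.1 x :=
  (continuous_apply x).comp continuous_subtype_val

theorem isPointwiseBounded_of_isCompact {K : Set (Cp X)} (hK : IsCompact K) :
    IsPointwiseBounded K :=
  fun x => (hK.image (continuous_eval x)).isBounded

theorem isClosed_boundedOn (S : Set X) (r : ℝ) : IsClosed (boundedOn S r) := by
  simp only [boundedOn, ofPred_forall]
  exact isClosed_biInter fun x _ => isClosed_le (continuous_eval x).abs continuous_const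

theorem exists_finset_eqOn_imp_mem_of_mem_nhds {f : Cp X} {U : Set (Cp X)} (hU : U ∈ 𝓝 f) :
    ∃ F : Finset X, ∀ g : Cp X, EqOn g.1 f.1 F → g ∈ U := by
  obtain ⟨O, hO, hOU⟩ := (mem_nhds_subtype _ f U).1 hU
  obtain ⟨O', hO'O, hO', hfO'⟩ := mem_nhds_iff.1 hO
  obtain ⟨F, u, hu, hFO'⟩ := isOpen_pi_iff.1 hO' f.1 hfO'
  refine ⟨F, fun g hg => hOU (hO'O (hFO' fun a ha => ?_))⟩
  rw [hg ha]
  exact (hu a ha).2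

theorem isNowhereDense_boundedOn (hsep : SeparatesPoints {f : X → ℝ | Continuous f}) {S : Set X}
    (hS : S.Infinite) (r : ℝ) : IsNowhereDense (boundedOn S r) := by
  rw [(isClosed_boundedOn S r).isNowhereDense_iff, eq_empty_iff_forall_notMem]
  intro f hf
  obtain ⟨F, hF⟩ := exists_finset_eqOn_imp_mem_of_mem_nhds (mem_interior_iff_mem_nhds.1 hf)
  obtain ⟨x, hxS, hxF⟩ := hS.exists_notMem_finset F
  obtain ⟨φ, hφ, hφF, hφx⟩ := exists_continuous_eqOn_zero_eq_one hsep hxF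
  let g : Cp X := ⟨fun y => f.1 y + (r + 1 - f.1 x) * φ y, f.2.add (hφ.const_mul _)⟩
  have hg : g ∈ boundedOn S r := hF g fun a ha => by simp [g, hφF ha]
  have hgx : g.1 x = r + 1 := by simp [g, hφx]
  linarith [le_abs_self (g.1 x), hg x hxS]

theorem infinite_setOf_exists_lt_abs {K : Set (Cp X)} (hK : IsPointwiseBounded K) {S : Set X}
    (hS : ∀ n : ℕ, ¬ K ⊆ boundedOn S n) (r : ℝ) :
    {x ∈ S | ∃ f ∈ K, r < |f.1 x|}.Infinite := by
  intro hfin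
  obtain ⟨C, hC⟩ := ((isBounded_biUnion hfin).2 fun x _ => hK x).exists_norm_le
  obtain ⟨n, hn⟩ := exists_nat_ge (max r C)
  refine hS n fun f hf x hx => ?_
  rcases le_or_gt |f.1 x| r with hfx | hfx
  · exact hfx.trans ((le_max_left r C).trans hn)
  · have hfxC : |f.1 x| ≤ C := hC _ (mem_biUnion ⟨hx, f, hf, hfx⟩ (mem_image_of_mem _ hf))
    exact hfxC.trans ((le_max_right r C).trans hn)

theorem finite_setOf_lt_abs {ι : Type*} {K : Set (Cp X)} (hK : IsPointwiseBounded K)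
    {f : ι → Cp X} (hf : ∀ i, f i ∈ K) {e : ι → ℕ} (he : Injective e) (x : X) :
    {i | (e i : ℝ) < |(f i).1 x|}.Finite := by
  obtain ⟨C, hC⟩ := (hK x).exists_norm_le
  obtain ⟨n, hn⟩ := exists_nat_ge C
  refine ((finite_Iio n).preimage he.injOn).subset fun i hi => ?_
  have hfC : |(f i).1 x| ≤ C := hC _ (mem_image_of_mem _ (hf i))
  exact Nat.cast_lt.1 (hi.trans_le (hfC.trans hn))

theorem exists_pairwise_disjoint_isGδ_of_not_subset_boundedOn [T2Space X] {ι κ : Type*}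
    [Countable ι] [Countable κ] {K : Set (Cp X)} (hK : IsPointwiseBounded K) {S : ι → Set X}
    (hS : ∀ i (n : ℕ), ¬ K ⊆ boundedOn (S i) n) :
    ∃ G : κ → Set X, (∀ k, IsGδ (G k)) ∧ Pairwise (Disjoint on G) ∧
      ∀ k i, (G k ∩ S i).Nonempty := by
  obtain ⟨e, he⟩ := exists_injective_nat (κ × ι)
  obtain ⟨z, hz, hzmem⟩ := exists_injective_forall_mem_of_infinite fun p : κ × ι =>
    infinite_setOf_exists_lt_abs hK (hS p.2) (e p)
  choose hzS f hfK hfz using hzmem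
  obtain ⟨H, hH, hzH, hdisj⟩ := exists_pairwise_disjoint_isGδ_of_injective hz
  let V : κ × ι → Set X := fun p => {x | (e p : ℝ) < |(f p).1 x|}
  have hV : ∀ p, IsOpen (V p) := fun p => isOpen_lt continuous_const (f p).2.abs
  have hVfin : ∀ k x, {i | x ∈ V (k, i)}.Finite := fun k x =>
    finite_setOf_lt_abs hK (fun i => hfK (k, i)) (he.comp (Prod.mk_right_injective k)) x
  refine ⟨fun k => ⋃ i, H (k, i) ∩ V (k, i), fun k => ?_, fun k l hkl => ?_, fun k i => ?_⟩
  · exact isGδ_iUnion_of_pointFinite (fun i => (hH (k, i)).inter (hV (k, i)).isGδ)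
      (fun i => hV (k, i)) (hVfin k) fun i => inter_subset_right
  · refine disjoint_iUnion_left.2 fun i => disjoint_iUnion_right.2 fun j => ?_
    have hne : (k, i) ≠ (l, j) := fun h => hkl (congrArg Prod.fst h)
    exact (hdisj hne).mono inter_subset_left inter_subset_left
  · exact ⟨z (k, i), mem_iUnion.2 ⟨i, hzH (k, i), hfz (k, i)⟩, hzS (k, i)⟩

end Cp

theorem mainTheorem6_general {X : Type*} [TopologicalSpace X]
    (hsep : SeparatesPoints {f : X → ℝ | Continuous f}) (hX : IsAiry X) :
    ∃ A : ℕ → Set (Cp X), (∀ n, IsClosed (A n) ∧ IsNowhereDense (A n)) ∧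
      ∀ K : Set (Cp X), Cp.IsPointwiseBounded K → ∃ n, K ⊆ A n := by
  obtain ⟨P, hP, hinf, hmeet⟩ := hX
  have : T2Space X := ⟨fun x y hxy =>
    let ⟨_, hf, hfxy⟩ := hsep hxy
    separated_by_continuous hf hfxy⟩
  have : Countable P := hP.to_subtype
  have : Nonempty P := by
    by_contra hempty
    have hdense : FamilyDense P ∅ := fun S hS => (hempty ⟨S, hS⟩).elim
    simpa using hmeet ∅ ∅ .empty .empty hdense hdense
  obtain ⟨e, he⟩ := exists_surjective_nat (P × ℕ)
  refine ⟨fun m => Cp.boundedOn (e m).1 (e m).2, fun m => ⟨Cp.isClosed_boundedOn _ _,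
    Cp.isNowhereDense_boundedOn hsep (hinf _ (e m).1.2) _⟩, fun K hK => ?_⟩
  by_contra! hK_not
  have hunbdd : ∀ (S : P) (n : ℕ), ¬ K ⊆ Cp.boundedOn S n := fun S n => by
    obtain ⟨m, hm⟩ := he (S, n)
    simpa only [hm] using hK_not m
  obtain ⟨G, hG, hdisj, hGS⟩ :=
    Cp.exists_pairwise_disjoint_isGδ_of_not_subset_boundedOn (κ := Bool) hK hunbdd
  have hdense : ∀ b, FamilyDense P (G b) := fun b S hS => hGS b ⟨S, hS⟩
  exact (hmeet _ _ (hG false) (hG true) (hdense false) (hdense true)).ne_empty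
    (hdisj Bool.false_ne_true).inter_eq

theorem mainTheorem6 {X : Type*} [TopologicalSpace X] [T35Space X] (hX : IsAiry X) :
    BanakhProperty (Cp X) := by
  obtain ⟨A, hA, hcover⟩ := mainTheorem6_general separatesPoints_continuous_of_t35Space hX
  exact ⟨A, hA, fun K hK => hcover K (Cp.isPointwiseBounded_of_isCompact hK)⟩
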